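/- Let $X$ be a compact connected surface, possibly with boundary, with a finite cell division $T$ into triangles, with vertices $v_1,\dots,v_N$, edge set $E$ and triangle set $F$ (for instance a triangulation, or a generalized triangulation, that is, a cell division whose lift to the universal cover of $X$ is a triangulation; sides or corners of one triangle may be identified with each other), and let $\Phi : E\to[0,\pi/2]$ be a weight. Let the background geometry be $\mathbb E^2$, with $s(x)=x$, or $\mathbb H^2$ (curvature $-1$), with $s(x)=\sinh x$. For radii $r=(r_1,\dots,r_N)\in\mathbb R_{>0}^N$, realize every triangle of $T$ as the triangle in the background geometry formed by the centers of three circles whose radii are those assigned to its corners and which meet pairwise in the (exterior) intersection angles given by the weights of its sides. Let $a_i$ be the sum of all inner angles at $v_i$, and let $K_i=2\pi-a_i$ if $v_i$ is an interior point of $X$ and $K_i=\pi-a_i$ if $v_i\in\partial X$. The combinatorial Ricci flow is $$(3.1)\qquad \frac{dr_i(t)}{dt}=-K_i(r(t))\,s(r_i(t)),\qquad i=1,\dots,N .$$ **Proposition 3.4 (with Corollary 3.6).** (a) In both background geometries, for every initial value $r(0)\in\mathbb R_{>0}^N$ the solution of (3.1) with this initial value exists for all time $t\ge 0$: there is a solution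 $r:[0,\infty)\to\mathbb R_{>0}^N$, and every solution with the same initial value on an interval $[0,a)$ agrees with it there. (b) In hyperbolic background geometry, for every solution $r(t)$, $t\ge0$, of (3.1) there is a constant $C$ such that $r_i(t)\le C$ for all $t\ge 0$ and all $i$. -/

import Mathlib

open scoped Manifold

namespace CombinatorialRicciFlow

/-! ### The two background planes -/

/-- The background geometries: the Euclidean plane `E²` and the hyperbolic plane `H²`. -/
inductive Geometry
  | euclidean
  | hyperbolic

/-- The points of the background plane: the complex plane with its Euclidean metric, or the
Poincaré upper half-plane with its hyperbolic metric of curvature `-1`. -/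
def Plane : Geometry → Type
  | .euclidean => ℂ
  | .hyperbolic => UpperHalfPlane

/-- The distance of the background plane. -/
noncomputable def planeDist : (G : Geometry) → Plane G → Plane G → ℝ
  | .euclidean, p, q => dist (α := ℂ) p q
  | .hyperbolic, p, q => dist (α := UpperHalfPlane) p q

/-- The position of `q` in the Poincaré disc after the conformal isometry
`z ↦ (z - p) / (z - conj p)` from the upper half-plane onto the disc, which moves `p` to the
centre. Geodesics from `p` become rays from `0`. -/
noncomputable def discCoord (p q : UpperHalfPlane) : ℂ :=
  ((q : ℂ) - (p : ℂ)) / ((q : ℂ) - (starRingEnd ℂ) (p : ℂ))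

/-- The angle at the middle point `p` between the geodesics from `p` to `q` and from `p` to `r`.
In the hyperbolic plane it is read off in the conformal disc model centred at `p`. -/
noncomputable def planeAngle : (G : Geometry) → Plane G → Plane G → Plane G → ℝ
  | .euclidean, q, p, r => EuclideanGeometry.angle (P := ℂ) q p r
  | .hyperbolic, q, p, r => InnerProductGeometry.angle (discCoord p q) (discCoord p r)

/-- The circles of centre `p`, radius `r` and of centre `q`, radius `s` meet at the (exterior)
intersection angle `φ`: at a common point `x` the two radii make the angle `π - φ`. For `φ = 0`
the circles are externally tangent, for `φ = π / 2` they are orthogonal. -/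
def CirclesMeet (G : Geometry) (p : Plane G) (r : ℝ) (q : Plane G) (s : ℝ) (φ : ℝ) : Prop :=
  ∃ x : Plane G, planeDist G x p = r ∧ planeDist G x q = s ∧ planeAngle G p x q = Real.pi - φ

/-- `θ` is the angle at the first centre in a triangle formed by the centres of three circles of
radii `r₁, r₂, r₃`, where `φ₁` is the intersection angle of the second and third circles, `φ₂`
that of the third and first, and `φ₃` that of the first and second. -/
def IsInnerAngle (G : Geometry) (r₁ r₂ r₃ φ₁ φ₂ φ₃ θ : ℝ) : Prop :=
  ∃ p₁ p₂ p₃ : Plane G,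
    CirclesMeet G p₂ r₂ p₃ r₃ φ₁ ∧ CirclesMeet G p₃ r₃ p₁ r₁ φ₂ ∧ CirclesMeet G p₁ r₁ p₂ r₂ φ₃ ∧
      planeAngle G p₂ p₁ p₃ = θ

/-- The inner angle at the first centre of the triangle formed by the centres of three circles.
By `isInnerAngle_iff` below, it is well defined for positive radii and intersection angles
in `[0, π / 2]`. -/
noncomputable def innerAngle (G : Geometry) (r₁ r₂ r₃ φ₁ φ₂ φ₃ : ℝ) : ℝ :=
  Classical.epsilon (IsInnerAngle G r₁ r₂ r₃ φ₁ φ₂ φ₃)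

/-! ### The inner angle is well defined -/

/-- The cosine of the angle between sides of lengths `a` and `b` that is opposite to a side of
length `c`, as given by the law of cosines. -/
noncomputable def lawCos : Geometry → ℝ → ℝ → ℝ → ℝ
  | .euclidean, a, b, c => (a ^ 2 + b ^ 2 - c ^ 2) / (2 * a * b)
  | .hyperbolic, a, b, c =>
      (Real.cosh a * Real.cosh b - Real.cosh c) / (Real.sinh a * Real.sinh b)

/-- The distance of the centres of two circles of radii `r` and `s` that meet at angle `φ`. -/
noncomputable def sideLength : Geometry → ℝ → ℝ → ℝ → ℝ
  | .euclidean, φ, r, s => Real.sqrt (r ^ 2 + s ^ 2 + 2 * r * s * Real.cos φ)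
  | .hyperbolic, φ, r, s =>
      Real.arcosh (Real.cosh r * Real.cosh s + Real.cos φ * (Real.sinh r * Real.sinh s))

theorem planeDist_comm (G : Geometry) (p q : Plane G) : planeDist G p q = planeDist G q p := by
  cases G
  · exact dist_comm (α := ℂ) p q
  · exact dist_comm (α := UpperHalfPlane) p q

theorem planeDist_nonneg (G : Geometry) (p q : Plane G) : 0 ≤ planeDist G p q := by
  cases G
  · exact dist_nonneg (α := ℂ)
  · exact dist_nonneg (α := UpperHalfPlane)

theorem planeAngle_comm (G : Geometry) (q p r : Plane G) :
    planeAngle G q p r = planeAngle G r p q := by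
  cases G
  · exact EuclideanGeometry.angle_comm (P := ℂ) q p r
  · exact InnerProductGeometry.angle_comm _ _

theorem planeAngle_mem (G : Geometry) (q p r : Plane G) :
    planeAngle G q p r ∈ Set.Icc 0 Real.pi := by
  cases G
  · exact ⟨EuclideanGeometry.angle_nonneg (P := ℂ) q p r, EuclideanGeometry.angle_le_pi (P := ℂ) q p r⟩
  · exact ⟨InnerProductGeometry.angle_nonneg _ _, InnerProductGeometry.angle_le_pi _ _⟩

theorem sub_conj_ne_zero (p q : UpperHalfPlane) :
    (q : ℂ) - (starRingEnd ℂ) (p : ℂ) ≠ 0 := by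
  intro h
  have := congrArg Complex.im h
  simp at this
  have h1 := p.im_pos
  have h2 := q.im_pos
  linarith

theorem norm_discCoord (p q : UpperHalfPlane) :
    ‖discCoord p q‖ = Real.tanh (dist p q / 2) := by
  rw [dist_comm, UpperHalfPlane.tanh_half_dist, discCoord, norm_div, dist_eq_norm, dist_eq_norm]

theorem hyperbolic_law_cos (q p r : UpperHalfPlane) :
    Real.cosh (dist q r) = Real.cosh (dist p q) * Real.cosh (dist p r) -
      Real.sinh (dist p q) * Real.sinh (dist p r) *
        Real.cos (InnerProductGeometry.angle (discCoord p q) (discCoord p r)) := by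
  have hp := p.im_pos
  have hq := q.im_pos
  have hr := r.im_pos
  have sinh_eq : ∀ z : UpperHalfPlane, Real.sinh (dist p z) =
      ‖discCoord p z‖ * (Complex.normSq ((z : ℂ) - (starRingEnd ℂ) (p : ℂ)) / (2 * p.im * z.im)) := by
    intro z
    have hz := z.im_pos
    have hne : ‖(z : ℂ) - (starRingEnd ℂ) (p : ℂ)‖ ≠ 0 := norm_ne_zero_iff.2 (sub_conj_ne_zero p z)
    have h2 : Real.sinh (dist p z) = 2 * Real.sinh (dist z p / 2) * Real.cosh (dist z p / 2) := by
      rw [← Real.sinh_two_mul, dist_comm]; ring_nf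
    have hs : Real.sqrt (z.im * p.im) ^ 2 = z.im * p.im := Real.sq_sqrt (by positivity)
    have hs0 : Real.sqrt (z.im * p.im) ≠ 0 := by positivity
    rw [h2, UpperHalfPlane.sinh_half_dist, UpperHalfPlane.cosh_half_dist, discCoord, norm_div,
      dist_eq_norm, dist_eq_norm, Complex.normSq_eq_norm_sq]
    field_simp
    rw [hs]
    ring
  have hin := InnerProductGeometry.cos_angle_mul_norm_mul_norm (discCoord p q) (discCoord p r)
  have key : Real.sinh (dist p q) * Real.sinh (dist p r) *
        Real.cos (InnerProductGeometry.angle (discCoord p q) (discCoord p r)) =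
      (inner ℝ (discCoord p q) (discCoord p r)) *
        (Complex.normSq ((q : ℂ) - (starRingEnd ℂ) (p : ℂ)) / (2 * p.im * q.im)) *
        (Complex.normSq ((r : ℂ) - (starRingEnd ℂ) (p : ℂ)) / (2 * p.im * r.im)) := by
    rw [sinh_eq, sinh_eq, ← hin]; ring
  have inner_eq : ∀ a b c d : ℂ, b ≠ 0 → d ≠ 0 →
      inner ℝ (a / b) (c / d) * Complex.normSq b * Complex.normSq d =
        (starRingEnd ℂ a * b * (c * starRingEnd ℂ d)).re := by
    intro a b c d hb hd
    rw [Complex.inner, mul_assoc, ← Complex.re_mul_ofReal]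
    congr 1
    have hb' : starRingEnd ℂ b ≠ 0 := by simpa using hb
    have hd' : starRingEnd ℂ d ≠ 0 := by simpa using hd
    rw [Complex.ofReal_mul, ← Complex.mul_conj, ← Complex.mul_conj, map_div₀]
    field_simp
  have h3 := inner_eq ((q : ℂ) - p) _ ((r : ℂ) - p) _ (sub_conj_ne_zero p q) (sub_conj_ne_zero p r)
  have h4 : inner ℝ (discCoord p q) (discCoord p r) *
        (Complex.normSq ((q : ℂ) - (starRingEnd ℂ) (p : ℂ)) / (2 * p.im * q.im)) *
        (Complex.normSq ((r : ℂ) - (starRingEnd ℂ) (p : ℂ)) / (2 * p.im * r.im)) =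
      (starRingEnd ℂ ((q : ℂ) - p) * ((q : ℂ) - (starRingEnd ℂ) (p : ℂ)) *
        (((r : ℂ) - p) * starRingEnd ℂ ((r : ℂ) - (starRingEnd ℂ) (p : ℂ)))).re /
        (2 * p.im * q.im * (2 * p.im * r.im)) := by
    rw [← h3, discCoord, discCoord]
    field_simp
  rw [key, h4, UpperHalfPlane.cosh_dist, UpperHalfPlane.cosh_dist, UpperHalfPlane.cosh_dist]
  simp only [dist_eq_norm, ← Complex.normSq_eq_norm_sq, map_sub, Complex.conj_conj,
    Complex.mul_re, Complex.mul_im, Complex.normSq_apply, Complex.sub_re, Complex.sub_im,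
    Complex.conj_re, Complex.conj_im, UpperHalfPlane.coe_re, UpperHalfPlane.coe_im]
  field_simp
  ring

theorem cos_planeAngle (G : Geometry) (q p r : Plane G) (hq : 0 < planeDist G p q)
    (hr : 0 < planeDist G p r) :
    Real.cos (planeAngle G q p r) =
      lawCos G (planeDist G p q) (planeDist G p r) (planeDist G q r) := by
  cases G
  · have h := EuclideanGeometry.law_cos (P := ℂ) q p r
    simp only [planeDist] at hq hr
    simp only [planeAngle, planeDist, lawCos]
    rw [dist_comm (α := ℂ) q p, dist_comm (α := ℂ) r p] at h
    rw [eq_div_iff (by positivity)]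
    linarith
  · have h := hyperbolic_law_cos q p r
    simp only [planeDist] at hq hr
    simp only [planeAngle, planeDist, lawCos]
    have h1 := Real.sinh_pos_iff.2 hq
    have h2 := Real.sinh_pos_iff.2 hr
    rw [eq_div_iff (by positivity)]
    linarith

theorem lawCos_injOn (G : Geometry) {a b c d : ℝ} (ha : 0 < a) (hb : 0 < b) (hc : 0 ≤ c)
    (hd : 0 ≤ d) (h : lawCos G a b c = lawCos G a b d) : c = d := by
  cases G
  · simp only [lawCos] at h
    rw [div_left_inj' (by positivity)] at h
    exact (sq_eq_sq₀ hc hd).1 (by linarith)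
  · simp only [lawCos] at h
    have h1 := Real.sinh_pos_iff.2 ha
    have h2 := Real.sinh_pos_iff.2 hb
    rw [div_left_inj' (by positivity)] at h
    have h3 : Real.cosh c = Real.cosh d := by linarith
    have h4 : |c| ≤ |d| := Real.cosh_le_cosh.1 h3.le
    have h5 : |d| ≤ |c| := Real.cosh_le_cosh.1 h3.ge
    rw [abs_of_nonneg hc, abs_of_nonneg hd] at h4 h5
    exact le_antisymm h4 h5

theorem lawCos_mem (G : Geometry) {a b c : ℝ} (ha : 0 < a) (hb : 0 < b) (hc : 0 < c)
    (h1 : c ≤ a + b) (h2 : a ≤ b + c) (h3 : b ≤ a + c) :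
    -1 ≤ lawCos G a b c ∧ lawCos G a b c ≤ 1 := by
  cases G
  · simp only [lawCos]
    rw [div_le_one (by positivity), le_div_iff₀ (by positivity)]
    constructor <;> nlinarith
  · simp only [lawCos]
    have hsa := Real.sinh_pos_iff.2 ha
    have hsb := Real.sinh_pos_iff.2 hb
    rw [div_le_one (by positivity), le_div_iff₀ (by positivity)]
    have h4 : Real.cosh c ≤ Real.cosh (a + b) := by
      rw [Real.cosh_le_cosh, abs_of_pos hc, abs_of_pos (by linarith)]; exact h1
    have h5 : Real.cosh (a - b) ≤ Real.cosh c := by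
      rw [Real.cosh_le_cosh, abs_of_pos hc, abs_le]; constructor <;> linarith
    rw [Real.cosh_add] at h4
    rw [Real.cosh_sub] at h5
    constructor <;> linarith

theorem lawCos_comm (G : Geometry) (a b c : ℝ) : lawCos G a b c = lawCos G b a c := by
  cases G <;> simp only [lawCos] <;> ring

theorem angle_rotate {u : ℂ} (hu : u ≠ 0) {t θ : ℝ} (ht : 0 < t) (hθ : θ ∈ Set.Icc 0 Real.pi) :
    InnerProductGeometry.angle u ((t : ℂ) * (u * Complex.exp (θ * Complex.I))) = θ := by
  rw [← Complex.real_smul, InnerProductGeometry.angle_smul_right_of_pos _ _ ht]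
  nth_rewrite 1 [← mul_one u]
  rw [Complex.angle_mul_left hu, Complex.angle_one_left (Complex.exp_ne_zero _),
    Complex.arg_exp_mul_I, (toIocMod_eq_self Real.two_pi_pos).2, abs_of_nonneg hθ.1]
  constructor <;> linarith [hθ.1, hθ.2, Real.pi_pos]

theorem exists_point (G : Geometry) (q p : Plane G) (hq : 0 < planeDist G p q) {b θ : ℝ}
    (hb : 0 < b) (hθ : θ ∈ Set.Icc 0 Real.pi) :
    ∃ r : Plane G, planeDist G p r = b ∧ planeAngle G q p r = θ := by
  cases G
  · change ℂ at p q
    change 0 < dist p q at hq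
    have hu : q - p ≠ 0 := by
      intro h
      rw [sub_eq_zero.1 h, dist_self] at hq
      exact lt_irrefl _ hq
    have hn : 0 < ‖q - p‖ := norm_pos_iff.2 hu
    refine ⟨p + ((b / ‖q - p‖ : ℝ) : ℂ) * ((q - p) * Complex.exp (θ * Complex.I)), ?_, ?_⟩
    · simp only [planeDist]
      rw [dist_eq_norm]
      simp only [sub_add_cancel_left, norm_neg, norm_mul, Complex.norm_exp_ofReal_mul_I,
        Complex.norm_real, norm_div, Real.norm_eq_abs, abs_of_pos hb, abs_of_pos hn]
      field_simp
    · simp only [planeAngle, EuclideanGeometry.angle, vsub_eq_sub, add_sub_cancel_left]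
      exact angle_rotate hu (by positivity) hθ
  · change UpperHalfPlane at p q
    change 0 < dist p q at hq
    have hn : 0 < ‖discCoord p q‖ := by
      rw [norm_discCoord, Real.tanh_eq_sinh_div_cosh]
      exact div_pos (Real.sinh_pos_iff.2 (by linarith)) (Real.cosh_pos _)
    have hu : discCoord p q ≠ 0 := norm_pos_iff.1 hn
    have ht : 0 < Real.tanh (b / 2) := by
      rw [Real.tanh_eq_sinh_div_cosh]
      exact div_pos (Real.sinh_pos_iff.2 (by linarith)) (Real.cosh_pos _)
    have htp : 0 < Real.tanh (b / 2) / ‖discCoord p q‖ := div_pos ht hn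
    obtain ⟨v, hv⟩ : ∃ v : ℂ, v = ((Real.tanh (b / 2) / ‖discCoord p q‖ : ℝ) : ℂ) *
      (discCoord p q * Complex.exp (θ * Complex.I)) := ⟨_, rfl⟩
    have hvn : ‖v‖ = Real.tanh (b / 2) := by
      rw [hv]
      simp only [norm_mul, Complex.norm_exp_ofReal_mul_I, Complex.norm_real, norm_div,
        Real.norm_eq_abs, abs_of_pos ht, abs_of_pos hn]
      field_simp
    have hv1 : ‖v‖ < 1 := by rw [hvn]; exact Real.tanh_lt_one _
    have hne : 1 - v ≠ 0 := by
      intro h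
      rw [← sub_eq_zero.1 h, norm_one] at hv1
      exact lt_irrefl _ hv1
    have hp := p.im_pos
    have him : 0 < (((p : ℂ) - starRingEnd ℂ (p : ℂ) * v) / (1 - v)).im := by
      have hN : 0 < Complex.normSq (1 - v) := Complex.normSq_pos.2 hne
      have hvs : v.re * v.re + v.im * v.im < 1 := by
        rw [← Complex.normSq_apply, Complex.normSq_eq_norm_sq]
        nlinarith [norm_nonneg v]
      have : (((p : ℂ) - starRingEnd ℂ (p : ℂ) * v) / (1 - v)).im =
          p.im * (1 - (v.re * v.re + v.im * v.im)) / Complex.normSq (1 - v) := by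
        rw [Complex.div_im, ← sub_div]
        congr 1
        simp
        ring
      rw [this]
      exact div_pos (mul_pos hp (by linarith)) hN
    have hd : discCoord p ⟨_, him⟩ = v := by
      have hpc : (p : ℂ) - starRingEnd ℂ (p : ℂ) ≠ 0 := sub_conj_ne_zero p p
      simp only [discCoord]
      rw [div_eq_iff (sub_conj_ne_zero p ⟨_, him⟩)]
      simp only
      field_simp
      ring
    refine ⟨⟨_, him⟩, ?_, ?_⟩
    · simp only [planeDist]
      have h1 := norm_discCoord p ⟨_, him⟩
      rw [hd, hvn] at h1
      have := Real.tanh_injective h1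
      linarith
    · simp only [planeAngle]
      rw [hd, hv]
      exact angle_rotate hu htp hθ

theorem exists_pair (G : Geometry) {a : ℝ} (ha : 0 < a) :
    ∃ p q : Plane G, planeDist G p q = a := by
  suffices h : ∃ p q : Plane G, 0 < planeDist G p q by
    obtain ⟨p, q, hpq⟩ := h
    obtain ⟨r, hr, -⟩ := exists_point G q p hpq ha ⟨le_rfl, Real.pi_pos.le⟩
    exact ⟨p, r, hr⟩
  cases G
  · exact ⟨(0 : ℂ), (1 : ℂ), by simp [planeDist]⟩
  · refine ⟨(UpperHalfPlane.I : UpperHalfPlane), (1 : ℝ) +ᵥ UpperHalfPlane.I, ?_⟩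
    simp only [planeDist]
    rw [dist_pos]
    intro h
    have := congrArg UpperHalfPlane.re h
    simp at this

theorem exists_third (G : Geometry) (q p : Plane G) {b c : ℝ} (ha : 0 < planeDist G p q)
    (hb : 0 < b) (hc : 0 < c) (h1 : c ≤ planeDist G p q + b) (h2 : planeDist G p q ≤ b + c)
    (h3 : b ≤ planeDist G p q + c) :
    ∃ r : Plane G, planeDist G p r = b ∧ planeDist G q r = c := by
  have hm := lawCos_mem G ha hb hc h1 h2 h3
  obtain ⟨r, hr, hθ⟩ := exists_point G q p ha hb
    ⟨Real.arccos_nonneg (lawCos G (planeDist G p q) b c), Real.arccos_le_pi _⟩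
  refine ⟨r, hr, ?_⟩
  have h := cos_planeAngle G q p r ha (hr ▸ hb)
  rw [hθ, hr, Real.cos_arccos hm.1 hm.2] at h
  exact (lawCos_injOn G ha hb hc.le (planeDist_nonneg _ _ _) h).symm

theorem sideLength_bounds (G : Geometry) {φ r s : ℝ} (hr : 0 < r) (hs : 0 < s)
    (hφ : φ ∈ Set.Icc 0 (Real.pi / 2)) :
    r ≤ sideLength G φ r s ∧ s ≤ sideLength G φ r s ∧ sideLength G φ r s ≤ r + s ∧
      lawCos G r s (sideLength G φ r s) = -Real.cos φ := by
  have hc0 : 0 ≤ Real.cos φ :=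
    Real.cos_nonneg_of_mem_Icc ⟨by linarith [hφ.1, Real.pi_pos], hφ.2⟩
  have hc1 : Real.cos φ ≤ 1 := Real.cos_le_one φ
  have hrs : 0 < r * s := mul_pos hr hs
  have hrsc : 0 ≤ r * s * Real.cos φ := mul_nonneg hrs.le hc0
  cases G
  · simp only [sideLength, lawCos]
    refine ⟨Real.le_sqrt_of_sq_le (by nlinarith), Real.le_sqrt_of_sq_le (by nlinarith),
      (Real.sqrt_le_left (by linarith)).2 (by nlinarith), ?_⟩
    rw [Real.sq_sqrt (by nlinarith), div_eq_iff (by positivity)]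
    ring
  · simp only [sideLength, lawCos]
    have h1 := Real.sinh_pos_iff.2 hr
    have h2 := Real.sinh_pos_iff.2 hs
    have h3 := Real.one_le_cosh r
    have h4 := Real.one_le_cosh s
    have h5 : 0 ≤ Real.cos φ * (Real.sinh r * Real.sinh s) := by positivity
    have hX : 1 ≤ Real.cosh r * Real.cosh s + Real.cos φ * (Real.sinh r * Real.sinh s) := by
      nlinarith
    have hA := Real.arcosh_nonneg hX
    refine ⟨?_, ?_, ?_, ?_⟩
    · refine (le_abs_self r).trans (le_of_le_of_eq ?_ (abs_of_nonneg hA))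
      rw [← Real.cosh_le_cosh, Real.cosh_arcosh hX]
      nlinarith
    · refine (le_abs_self s).trans (le_of_le_of_eq ?_ (abs_of_nonneg hA))
      rw [← Real.cosh_le_cosh, Real.cosh_arcosh hX]
      nlinarith
    · rw [← abs_of_nonneg hA, ← abs_of_pos (add_pos hr hs), ← Real.cosh_le_cosh,
        Real.cosh_arcosh hX, Real.cosh_add]
      nlinarith [mul_pos h1 h2]
    · rw [Real.cosh_arcosh hX, div_eq_iff (by positivity)]
      ring

theorem circlesMeet_iff (G : Geometry) (p q : Plane G) {r s φ : ℝ} (hr : 0 < r) (hs : 0 < s)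
    (hφ : φ ∈ Set.Icc 0 (Real.pi / 2)) :
    CirclesMeet G p r q s φ ↔ planeDist G p q = sideLength G φ r s := by
  obtain ⟨h1, h2, h3, h4⟩ := sideLength_bounds G hr hs hφ
  constructor
  · rintro ⟨x, hp, hq, hx⟩
    have h := cos_planeAngle G p x q (hp ▸ hr) (hq ▸ hs)
    rw [hx, hp, hq, Real.cos_pi_sub, ← h4] at h
    exact (lawCos_injOn G hr hs (by linarith) (planeDist_nonneg _ _ _) h).symm
  · intro h
    obtain ⟨x, hx1, hx2⟩ := exists_third G q p (b := r) (c := s) (by linarith) hr hs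
      (by linarith) (by linarith) (by linarith)
    rw [planeDist_comm] at hx1 hx2
    refine ⟨x, hx1, hx2, ?_⟩
    refine Real.injOn_cos (planeAngle_mem _ _ _ _) ⟨?_, ?_⟩ ?_
    · linarith [hφ.2, Real.pi_pos]
    · linarith [hφ.1]
    · rw [cos_planeAngle G p x q (hx1 ▸ hr) (hx2 ▸ hs), hx1, hx2, h, h4, Real.cos_pi_sub]

/-- Three circles of given positive radii and intersection angles in `[0, π / 2]` exist, and the
inner angle of the triangle of their centres is determined by the law of cosines. -/
theorem isInnerAngle_iff (G : Geometry) {r₁ r₂ r₃ φ₁ φ₂ φ₃ θ : ℝ} (h₁ : 0 < r₁) (h₂ : 0 < r₂)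
    (h₃ : 0 < r₃) (hφ₁ : φ₁ ∈ Set.Icc 0 (Real.pi / 2)) (hφ₂ : φ₂ ∈ Set.Icc 0 (Real.pi / 2))
    (hφ₃ : φ₃ ∈ Set.Icc 0 (Real.pi / 2)) :
    IsInnerAngle G r₁ r₂ r₃ φ₁ φ₂ φ₃ θ ↔
      θ = Real.arccos (lawCos G (sideLength G φ₃ r₁ r₂) (sideLength G φ₂ r₃ r₁)
        (sideLength G φ₁ r₂ r₃)) := by
  obtain ⟨a1, a2, a3, -⟩ := sideLength_bounds G h₁ h₂ hφ₃
  obtain ⟨b1, b2, b3, -⟩ := sideLength_bounds G h₃ h₁ hφ₂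
  obtain ⟨c1, c2, c3, -⟩ := sideLength_bounds G h₂ h₃ hφ₁
  have key : ∀ p₁ p₂ p₃ : Plane G, planeDist G p₂ p₃ = sideLength G φ₁ r₂ r₃ →
      planeDist G p₃ p₁ = sideLength G φ₂ r₃ r₁ → planeDist G p₁ p₂ = sideLength G φ₃ r₁ r₂ →
      planeAngle G p₂ p₁ p₃ = Real.arccos (lawCos G (sideLength G φ₃ r₁ r₂)
        (sideLength G φ₂ r₃ r₁) (sideLength G φ₁ r₂ r₃)) := by
    intro p₁ p₂ p₃ h23 h31 h12
    rw [planeDist_comm] at h31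
    rw [← h23, ← h31, ← h12, ← cos_planeAngle G p₂ p₁ p₃ (by linarith) (by linarith),
      Real.arccos_cos (planeAngle_mem _ _ _ _).1 (planeAngle_mem _ _ _ _).2]
  constructor
  · rintro ⟨p₁, p₂, p₃, h23, h31, h12, rfl⟩
    rw [circlesMeet_iff G _ _ (by assumption) (by assumption) (by assumption)] at h23 h31 h12
    exact key p₁ p₂ p₃ h23 h31 h12
  · rintro rfl
    obtain ⟨p₁, p₂, h12⟩ := exists_pair G (a := sideLength G φ₃ r₁ r₂) (by linarith)
    obtain ⟨p₃, h13, h23⟩ := exists_third G p₂ p₁ (b := sideLength G φ₂ r₃ r₁)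
      (c := sideLength G φ₁ r₂ r₃) (by linarith) (by linarith) (by linarith) (by linarith)
      (by linarith) (by linarith)
    rw [planeDist_comm] at h13
    refine ⟨p₁, p₂, p₃, ?_, ?_, ?_, key p₁ p₂ p₃ h23 h13 h12⟩ <;>
      rwa [circlesMeet_iff G _ _ (by assumption) (by assumption) (by assumption)]

theorem innerAngle_eq (G : Geometry) {r₁ r₂ r₃ φ₁ φ₂ φ₃ : ℝ} (h₁ : 0 < r₁) (h₂ : 0 < r₂)
    (h₃ : 0 < r₃) (hφ₁ : φ₁ ∈ Set.Icc 0 (Real.pi / 2)) (hφ₂ : φ₂ ∈ Set.Icc 0 (Real.pi / 2))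
    (hφ₃ : φ₃ ∈ Set.Icc 0 (Real.pi / 2)) :
    innerAngle G r₁ r₂ r₃ φ₁ φ₂ φ₃ =
      Real.arccos (lawCos G (sideLength G φ₃ r₁ r₂) (sideLength G φ₂ r₃ r₁)
        (sideLength G φ₁ r₂ r₃)) :=
  (isInnerAngle_iff G h₁ h₂ h₃ hφ₁ hφ₂ hφ₃).1
    (Classical.epsilon_spec ⟨_, (isInnerAngle_iff G h₁ h₂ h₃ hφ₁ hφ₂ hφ₃).2 rfl⟩)

/-! ### Surfaces divided into triangles -/

/-- The open `n`-simplex inside the closed standard simplex with `n + 1` vertices. -/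
def openSimplex (m : ℕ) : Set (stdSimplex ℝ (Fin m)) := {p | ∀ i, 0 < p i}

/-- A cell division of `X` into vertices (indexed by `V`), edges (indexed by `E`) and triangles
(indexed by `F`). Each edge and triangle is given by a characteristic map from a closed standard
simplex; these maps are injective on open simplices, but the sides or corners of one triangle may
be identified with each other. Side `i` of a triangle is the side opposite to its corner `i`. -/
structure TriangularCellDivision (X V E F : Type*) [TopologicalSpace X] where
  vertex : V → X
  edge : E → C(stdSimplex ℝ (Fin 2), X)
  face : F → C(stdSimplex ℝ (Fin 3), X)
  endpoint : E → Fin 2 → V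
  corner : F → Fin 3 → V
  side : F → Fin 3 → E
  /-- The end points of an edge are vertices. -/
  edge_vertex : ∀ e k, edge e (stdSimplex.vertex k) = vertex (endpoint e k)
  /-- The corners of a triangle are vertices. -/
  face_vertex : ∀ f i, face f (stdSimplex.vertex i) = vertex (corner f i)
  /-- The side of a triangle opposite to corner `i` is an edge, traversed in one of the two
  directions. -/
  face_side : ∀ f i, ∃ σ : Fin 2 → Fin 3, Function.Injective σ ∧ (∀ k, σ k ≠ i) ∧
    ∀ p, face f (stdSimplex.map σ p) = edge (side f i) p
  edge_injOn : ∀ e, Set.InjOn (edge e) (openSimplex 2)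
  face_injOn : ∀ f, Set.InjOn (face f) (openSimplex 3)
  /-- Every point lies in exactly one open cell. -/
  existsUnique_cell : ∀ x : X, ∃! c : V ⊕ E ⊕ F,
    x ∈ Sum.elim (fun v => {vertex v})
      (Sum.elim (fun e => edge e '' openSimplex 2) (fun f => face f '' openSimplex 3)) c

/-! ### Curvature and the flow -/

/-- The inner angle at corner `i` of the triangle `f`, realized in the background plane by the
centres of three circles whose radii are those of its corners and which meet at the angles given
by the weights of its sides. -/
noncomputable def cornerAngle {X V E F : Type*} [TopologicalSpace X] (G : Geometry)
    (T : TriangularCellDivision X V E F) (Φ : E → ℝ) (r : V → ℝ) (f : F) (i : Fin 3) : ℝ :=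
  innerAngle G (r (T.corner f i)) (r (T.corner f (i + 1))) (r (T.corner f (i + 2)))
    (Φ (T.side f i)) (Φ (T.side f (i + 1))) (Φ (T.side f (i + 2)))

open Classical in
/-- The cone angle at a vertex: the sum of all inner angles having this vertex. -/
noncomputable def coneAngle {X V E F : Type*} [TopologicalSpace X] [Fintype F] (G : Geometry)
    (T : TriangularCellDivision X V E F) (Φ : E → ℝ) (r : V → ℝ) (v : V) : ℝ :=
  ∑ f : F, ∑ i : Fin 3, if T.corner f i = v then cornerAngle G T Φ r f i else 0

open Classical in
/-- The curvature at a vertex of the metric with radii `r`: `2π` minus the cone angle at interior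
points of the surface `X`, and `π` minus the cone angle at boundary points. -/
noncomputable def curvature {X V E F : Type*} [TopologicalSpace X]
    [ChartedSpace (EuclideanHalfSpace 2) X] [Fintype F] (G : Geometry)
    (T : TriangularCellDivision X V E F) (Φ : E → ℝ) (r : V → ℝ) (v : V) : ℝ :=
  (if (𝓡∂ 2).IsBoundaryPoint (T.vertex v) then Real.pi else 2 * Real.pi) - coneAngle G T Φ r v

/-- The function `s` of the flow: `s(x) = x` for `E²` and `s(x) = sinh x` for `H²`. -/
noncomputable def sFun : Geometry → ℝ → ℝ
  | .euclidean, x => x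
  | .hyperbolic, x => Real.sinh x

/-- `r` solves the combinatorial Ricci flow `drᵥ/dt = -Kᵥ s(rᵥ)` on the time interval `J`, with
positive radii (the derivative is one-sided at an end point of `J`). -/
def IsRicciFlowOn {X V E F : Type*} [TopologicalSpace X]
    [ChartedSpace (EuclideanHalfSpace 2) X] [Fintype F] (G : Geometry)
    (T : TriangularCellDivision X V E F) (Φ : E → ℝ) (J : Set ℝ) (r : ℝ → V → ℝ) : Prop :=
  ∀ t ∈ J, ∀ v, 0 < r t v ∧
    HasDerivWithinAt (fun τ => r τ v) (-(curvature G T Φ (r t) v) * sFun G (r t v)) J t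

end CombinatorialRicciFlow

/-!
In the coordinates `u = log r` the flow becomes an equation `u' = logField u` on the whole vector
space `V → ℝ`, so positivity of the radii is automatic. The field is `C¹`: strict triangle
inequalities hold between the centres of the three circles (`lt_sideLength`), so the cosine of an
inner angle lies in `(-1, 1)`, where `arccos` is smooth (`contDiffAt_innerAngle`). Hence the
field is Lipschitz on balls, which gives uniqueness. Curvatures are bounded because a cone angle is
a sum of at most `3 * card F` numbers in `[0, π]`. In the Euclidean case `s r / r = 1`, so the field
is bounded, and a bounded field that is Lipschitz on balls has solutions for all time
(`exists_hasDerivWithinAt_Ici`).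

In the hyperbolic case `s r / r = sinh r / r` is unbounded for large `r`. Here the geometry helps:
the inner angle at a circle of radius `r₁` satisfies `cos θ ≥ 1 - 2 / sinh² r₁`, whatever the other
two radii are (`one_sub_le_lawCos_sideLength`). So there is a radius beyond which all cone angles
are less than `π` and the curvature is positive (`exists_curvature_hyperbolic_pos`). A radius that
large decreases, and this barrier bounds every solution; applied to the field truncated at the
barrier, which is bounded, the same argument gives solutions for all time
(`exists_logField_hyperbolic_solution`).
-/

namespace CombinatorialRicciFlow

/-! ### Ordinary differential equations with a bounded, locally Lipschitz field -/

section ODE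

open Set Metric

variable {E : Type*} [NormedAddCommGroup E] [NormedSpace ℝ E] {g : E → E}

theorem eqOn_Icc_of_hasDerivWithinAt (hg : ∀ R : ℝ, ∃ K, LipschitzOnWith K g (closedBall 0 R))
    {x y : ℝ → E} {b : ℝ} (hx : ∀ t ∈ Icc 0 b, HasDerivWithinAt x (g (x t)) (Icc 0 b) t)
    (hy : ∀ t ∈ Icc 0 b, HasDerivWithinAt y (g (y t)) (Icc 0 b) t) (h0 : x 0 = y 0) :
    EqOn x y (Icc 0 b) := by
  have hxc : ContinuousOn x (Icc 0 b) := fun t ht => (hx t ht).continuousWithinAt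
  have hyc : ContinuousOn y (Icc 0 b) := fun t ht => (hy t ht).continuousWithinAt
  obtain ⟨R, hR⟩ := ((isCompact_Icc.image_of_continuousOn hxc).isBounded.union
    (isCompact_Icc.image_of_continuousOn hyc).isBounded).subset_closedBall 0
  obtain ⟨K, hK⟩ := hg R
  have right : ∀ t ∈ Ico 0 b, Icc 0 b ∈ nhdsWithin t (Ici t) := fun t ht =>
    Filter.mem_of_superset (Icc_mem_nhdsGE ht.2) (Icc_subset_Icc_left ht.1)
  exact ODE_solution_unique_of_mem_Icc_right (v := fun _ => g) (s := fun _ => closedBall 0 R)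
    (fun _ _ => hK) hxc
    (fun t ht => (hx t (Ico_subset_Icc_self ht)).mono_of_mem_nhdsWithin (right t ht))
    (fun t ht => hR (Or.inl (mem_image_of_mem x (Ico_subset_Icc_self ht)))) hyc
    (fun t ht => (hy t (Ico_subset_Icc_self ht)).mono_of_mem_nhdsWithin (right t ht))
    (fun t ht => hR (Or.inr (mem_image_of_mem y (Ico_subset_Icc_self ht)))) h0

/-- A field of norm at most `L` moves a point at most `L * b` in time `b`, so that Picard–Lindelöf
on the ball of that radius gives a solution on `[0, b]` for every `b`. -/
theorem exists_hasDerivWithinAt_Icc [CompleteSpace E]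
    (hg : ∀ R : ℝ, ∃ K, LipschitzOnWith K g (closedBall 0 R)) {L : ℝ} (hL : ∀ x, ‖g x‖ ≤ L)
    (x₀ : E) {b : ℝ} (hb : 0 ≤ b) :
    ∃ x : ℝ → E, x 0 = x₀ ∧ ∀ t ∈ Icc 0 b, HasDerivWithinAt x (g (x t)) (Icc 0 b) t := by
  have hL0 : 0 ≤ L := (norm_nonneg _).trans (hL x₀)
  obtain ⟨K, hK⟩ := hg (‖x₀‖ + L * b)
  have hpl : IsPicardLindelof (fun _ => g) (⟨0, le_rfl, hb⟩ : Icc 0 b) x₀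
      (NNReal.mk (L * b) (by positivity)) 0 (NNReal.mk L hL0) K :=
    { lipschitzOnWith := fun _ _ => hK.mono (closedBall_subset_closedBall' (by
        rw [dist_zero_right, NNReal.coe_mk, add_comm]))
      continuousOn := fun _ _ => continuousOn_const
      norm_le := fun _ _ x _ => hL x
      mul_max_le := by simp [hb] }
  exact hpl.exists_eq_forall_mem_Icc_hasDerivWithinAt₀

theorem exists_hasDerivWithinAt_Ici [CompleteSpace E]
    (hg : ∀ R : ℝ, ∃ K, LipschitzOnWith K g (closedBall 0 R)) {L : ℝ} (hL : ∀ x, ‖g x‖ ≤ L)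
    (x₀ : E) :
    ∃ x : ℝ → E, x 0 = x₀ ∧ ∀ t ∈ Ici 0, HasDerivWithinAt x (g (x t)) (Ici 0) t := by
  choose α hα0 hα using fun n : ℕ => exists_hasDerivWithinAt_Icc hg hL x₀ n.cast_nonneg
  have agree : ∀ m n : ℕ, m ≤ n → EqOn (α m) (α n) (Icc 0 m) := fun m n hmn =>
    have hsub : Icc (0 : ℝ) m ⊆ Icc 0 n := Icc_subset_Icc_right (Nat.cast_le.2 hmn)
    eqOn_Icc_of_hasDerivWithinAt hg (hα m) (fun t ht => (hα n t (hsub ht)).mono hsub)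
      ((hα0 m).trans (hα0 n).symm)
  have glue : ∀ n : ℕ, EqOn (fun t => α ⌈t⌉₊ t) (α n) (Icc 0 n) := fun n t ht =>
    agree _ _ (Nat.ceil_le.2 ht.2) ⟨ht.1, Nat.le_ceil t⟩
  refine ⟨fun t => α ⌈t⌉₊ t, hα0 _, fun t ht => ?_⟩
  have hlt : t < (⌈t⌉₊ + 1 : ℕ) := by
    push_cast
    exact (Nat.le_ceil t).trans_lt (lt_add_one _)
  have hmem : t ∈ Icc (0 : ℝ) (⌈t⌉₊ + 1 : ℕ) := ⟨ht, hlt.le⟩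
  have h := (hα _ t hmem).congr_of_mem (glue _) hmem
  rw [← glue _ hmem] at h
  refine h.mono_of_mem_nhdsWithin ?_
  rw [← Ici_inter_Iic]
  exact Filter.inter_mem self_mem_nhdsWithin (mem_nhdsWithin_of_mem_nhds (Iic_mem_nhds hlt))

theorem le_of_hasDerivWithinAt_neg {f f' : ℝ → ℝ} {C : ℝ}
    (hf : ∀ t ∈ Ici 0, HasDerivWithinAt f (f' t) (Ici 0) t) (h0 : f 0 ≤ C)
    (hneg : ∀ t ∈ Ici 0, f t = C → f' t < 0) {t : ℝ} (ht : 0 ≤ t) : f t ≤ C :=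
  image_le_of_deriv_right_lt_deriv_boundary (a := 0) (b := t) (B := fun _ => C) (B' := fun _ => 0)
    (fun s hs => ((hf s hs.1).mono Icc_subset_Ici_self).continuousWithinAt)
    (fun s hs => (hf s hs.1).mono (Ici_subset_Ici.2 hs.1)) h0 (fun s => hasDerivAt_const s C)
    (fun s hs => hneg s hs.1) ⟨ht, le_rfl⟩

end ODE

/-! ### Smoothness of the inner angle -/

theorem lt_sideLength (G : Geometry) {φ r s : ℝ} (hr : 0 < r) (hs : 0 < s)
    (hφ : φ ∈ Set.Icc 0 (Real.pi / 2)) : r < sideLength G φ r s := by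
  have hc : 0 ≤ Real.cos φ :=
    Real.cos_nonneg_of_mem_Icc ⟨by linarith [hφ.1, Real.pi_pos], hφ.2⟩
  cases G
  · exact Real.lt_sqrt_of_sq_lt (by nlinarith [mul_nonneg (mul_pos hr hs).le hc])
  · have h1 := Real.sinh_pos_iff.2 hr
    have h2 := Real.sinh_pos_iff.2 hs
    have h3 : 1 < Real.cosh s := Real.one_lt_cosh.2 hs.ne'
    have h4 : 0 ≤ Real.cos φ * (Real.sinh r * Real.sinh s) := by positivity
    have h5 : Real.cosh r < Real.cosh r * Real.cosh s +
        Real.cos φ * (Real.sinh r * Real.sinh s) := by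
      nlinarith [Real.cosh_pos r]
    have h6 := (Real.arcosh_lt_arcosh (Real.cosh_pos r) ((Real.cosh_pos r).trans h5)).2 h5
    rwa [Real.arcosh_cosh hr.le] at h6

theorem sideLength_comm (G : Geometry) (φ r s : ℝ) : sideLength G φ r s = sideLength G φ s r := by
  cases G <;> simp only [sideLength] <;> ring_nf

theorem lawCos_mem_Ioo (G : Geometry) {a b c : ℝ} (ha : 0 < a) (hb : 0 < b) (hc : 0 < c)
    (h1 : c < a + b) (h2 : a < b + c) (h3 : b < a + c) :
    lawCos G a b c ∈ Set.Ioo (-1) 1 := by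
  -- Equality would put `c` at the degenerate values `a + b` or `|a - b|`.
  have hm := lawCos_mem G ha hb hc h1.le h2.le h3.le
  refine ⟨lt_of_le_of_ne hm.1 fun h => ?_, lt_of_le_of_ne hm.2 fun h => ?_⟩
  · have : lawCos G a b (a + b) = -1 := by
      cases G
      · simp only [lawCos]
        rw [div_eq_iff (by positivity)]
        ring
      · have := Real.sinh_pos_iff.2 ha
        have := Real.sinh_pos_iff.2 hb
        simp only [lawCos]
        rw [div_eq_iff (by positivity), Real.cosh_add]
        ring
    exact h1.ne (lawCos_injOn G ha hb hc.le (by positivity) (h.symm.trans this.symm))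
  · have : lawCos G a b |a - b| = 1 := by
      cases G
      · simp only [lawCos]
        rw [div_eq_iff (by positivity), sq_abs]
        ring
      · have := Real.sinh_pos_iff.2 ha
        have := Real.sinh_pos_iff.2 hb
        simp only [lawCos]
        rw [div_eq_iff (by positivity), Real.cosh_abs, Real.cosh_sub]
        ring
    have h4 := lawCos_injOn G ha hb hc.le (abs_nonneg _) (h.trans this.symm)
    exact (abs_lt.2 ⟨by linarith, by linarith⟩ : |a - b| < c).ne' h4

section Smooth

variable {W : Type*} [NormedAddCommGroup W] [NormedSpace ℝ W] {x : W} {a b c : W → ℝ}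

theorem contDiffAt_sideLength (G : Geometry) {φ : ℝ} (hφ : φ ∈ Set.Icc 0 (Real.pi / 2))
    (ha : ContDiffAt ℝ 1 a x) (hb : ContDiffAt ℝ 1 b x) (ha0 : 0 < a x) (hb0 : 0 < b x) :
    ContDiffAt ℝ 1 (fun y => sideLength G φ (a y) (b y)) x := by
  have hc : 0 ≤ Real.cos φ :=
    Real.cos_nonneg_of_mem_Icc ⟨by linarith [hφ.1, Real.pi_pos], hφ.2⟩
  cases G
  · refine ContDiffAt.sqrt (by fun_prop) ?_
    positivity
  · refine (Real.contDiffAt_arcosh ?_).comp x (f := fun y => Real.cosh (a y) * Real.cosh (b y) +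
      Real.cos φ * (Real.sinh (a y) * Real.sinh (b y))) (by fun_prop)
    have h1 := Real.sinh_pos_iff.2 ha0
    have h2 := Real.sinh_pos_iff.2 hb0
    have h3 : 1 < Real.cosh (a x) := Real.one_lt_cosh.2 ha0.ne'
    have h4 : 0 ≤ Real.cos φ * (Real.sinh (a x) * Real.sinh (b x)) := by positivity
    simp only [Set.mem_Ioi]
    nlinarith [Real.one_le_cosh (b x)]

theorem contDiffAt_lawCos (G : Geometry) (ha : ContDiffAt ℝ 1 a x) (hb : ContDiffAt ℝ 1 b x)
    (hc : ContDiffAt ℝ 1 c x) (ha0 : 0 < a x) (hb0 : 0 < b x) :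
    ContDiffAt ℝ 1 (fun y => lawCos G (a y) (b y) (c y)) x := by
  cases G
  · exact ContDiffAt.div (by fun_prop) (by fun_prop) (by positivity)
  · have h1 := Real.sinh_pos_iff.2 ha0
    have h2 := Real.sinh_pos_iff.2 hb0
    exact ContDiffAt.div (by fun_prop) (by fun_prop) (by positivity)

theorem contDiffAt_innerAngle (G : Geometry) {φ₁ φ₂ φ₃ : ℝ} (hφ₁ : φ₁ ∈ Set.Icc 0 (Real.pi / 2))
    (hφ₂ : φ₂ ∈ Set.Icc 0 (Real.pi / 2)) (hφ₃ : φ₃ ∈ Set.Icc 0 (Real.pi / 2))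
    (ha : ContDiffAt ℝ 1 a x) (hb : ContDiffAt ℝ 1 b x) (hc : ContDiffAt ℝ 1 c x)
    (ha0 : ∀ y, 0 < a y) (hb0 : ∀ y, 0 < b y) (hc0 : ∀ y, 0 < c y) :
    ContDiffAt ℝ 1 (fun y => innerAngle G (a y) (b y) (c y) φ₁ φ₂ φ₃) x := by
  simp only [innerAngle_eq G (ha0 _) (hb0 _) (hc0 _) hφ₁ hφ₂ hφ₃]
  have a1 := lt_sideLength G (ha0 x) (hb0 x) hφ₃
  have a2 := lt_sideLength G (hb0 x) (ha0 x) hφ₃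
  have b1 := lt_sideLength G (hc0 x) (ha0 x) hφ₂
  have b2 := lt_sideLength G (ha0 x) (hc0 x) hφ₂
  have c1 := lt_sideLength G (hb0 x) (hc0 x) hφ₁
  have c2 := lt_sideLength G (hc0 x) (hb0 x) hφ₁
  rw [sideLength_comm] at a2 b2 c2
  have a3 := (sideLength_bounds G (ha0 x) (hb0 x) hφ₃).2.2.1
  have b3 := (sideLength_bounds G (hc0 x) (ha0 x) hφ₂).2.2.1
  have c3 := (sideLength_bounds G (hb0 x) (hc0 x) hφ₁).2.2.1
  have pa := ha0 x
  have pb := hb0 x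
  have pc := hc0 x
  obtain ⟨h1, h2⟩ := lawCos_mem_Ioo G (pa.trans a1) (pc.trans b1) (pb.trans c1)
    (by linarith) (by linarith) (by linarith)
  exact ContDiffAt.comp (g := Real.arccos) x (Real.contDiffAt_arccos h1.ne' h2.ne) (contDiffAt_lawCos G
    (contDiffAt_sideLength G hφ₃ ha hb pa pb) (contDiffAt_sideLength G hφ₂ hc ha pc pa)
    (contDiffAt_sideLength G hφ₁ hb hc pb pc) (pa.trans a1) (pc.trans b1))

end Smooth

/-! ### Large hyperbolic circles see small angles -/

theorem cosh_sideLength_hyperbolic {φ r s : ℝ} (hr : 0 < r) (hs : 0 < s)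
    (hφ : φ ∈ Set.Icc 0 (Real.pi / 2)) :
    Real.cosh (sideLength .hyperbolic φ r s) =
      Real.cosh r * Real.cosh s + Real.cos φ * (Real.sinh r * Real.sinh s) := by
  have hc : 0 ≤ Real.cos φ :=
    Real.cos_nonneg_of_mem_Icc ⟨by linarith [hφ.1, Real.pi_pos], hφ.2⟩
  have h1 := Real.sinh_pos_iff.2 hr
  have h2 := Real.sinh_pos_iff.2 hs
  have h3 : 0 ≤ Real.cos φ * (Real.sinh r * Real.sinh s) := by positivity
  exact Real.cosh_arcosh (by nlinarith [Real.one_le_cosh r, Real.one_le_cosh s])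

theorem sinh_mul_cosh_le_sinh_sideLength {φ r s : ℝ} (hr : 0 < r) (hs : 0 < s)
    (hφ : φ ∈ Set.Icc 0 (Real.pi / 2)) :
    Real.sinh r * Real.cosh s ≤ Real.sinh (sideLength .hyperbolic φ r s) := by
  have hc : 0 ≤ Real.cos φ :=
    Real.cos_nonneg_of_mem_Icc ⟨by linarith [hφ.1, Real.pi_pos], hφ.2⟩
  have h1 := Real.sinh_pos_iff.2 hr
  have h2 := Real.sinh_pos_iff.2 hs
  have h3 : Real.cosh r * Real.cosh s ≤ Real.cosh (sideLength .hyperbolic φ r s) := by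
    rw [cosh_sideLength_hyperbolic hr hs hφ]
    exact le_add_of_nonneg_right (by positivity)
  have h4 : 0 < Real.sinh (sideLength .hyperbolic φ r s) :=
    Real.sinh_pos_iff.2 (hr.trans (lt_sideLength _ hr hs hφ))
  have h5 := pow_le_pow_left₀ (by positivity) h3 2
  refine le_of_sq_le_sq ?_ h4.le
  rw [mul_pow, Real.cosh_sq (sideLength _ _ _ _), Real.cosh_sq r] at h5
  rw [mul_pow]
  nlinarith [Real.one_le_cosh s]

/-- The bound does not involve the other two radii. It comes from
`1 - cos θ ≤ cosh ℓ₁ / (sinh ℓ₂ * sinh ℓ₃)` for the side lengths `ℓᵢ`, together with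
`cosh ℓ₁ ≤ 2 * cosh r₂ * cosh r₃`, `sinh ℓ₂ ≥ sinh r₁ * cosh r₃` and
`sinh ℓ₃ ≥ sinh r₁ * cosh r₂`. -/
theorem one_sub_le_lawCos_sideLength {r₁ r₂ r₃ φ₁ φ₂ φ₃ : ℝ} (h₁ : 0 < r₁) (h₂ : 0 < r₂)
    (h₃ : 0 < r₃) (hφ₁ : φ₁ ∈ Set.Icc 0 (Real.pi / 2)) (hφ₂ : φ₂ ∈ Set.Icc 0 (Real.pi / 2))
    (hφ₃ : φ₃ ∈ Set.Icc 0 (Real.pi / 2)) :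
    1 - 2 / Real.sinh r₁ ^ 2 ≤ lawCos .hyperbolic (sideLength .hyperbolic φ₃ r₁ r₂)
      (sideLength .hyperbolic φ₂ r₃ r₁) (sideLength .hyperbolic φ₁ r₂ r₃) := by
  have hA := sinh_mul_cosh_le_sinh_sideLength h₁ h₂ hφ₃
  have hB := sinh_mul_cosh_le_sinh_sideLength h₁ h₃ hφ₂
  rw [sideLength_comm] at hB
  have s1 := Real.sinh_pos_iff.2 h₁
  have s2 := Real.sinh_pos_iff.2 h₂
  have s3 := Real.sinh_pos_iff.2 h₃
  have c2 := Real.cosh_pos r₂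
  have c3 := Real.cosh_pos r₃
  have hC : Real.cosh (sideLength .hyperbolic φ₁ r₂ r₃) ≤ 2 * (Real.cosh r₂ * Real.cosh r₃) := by
    rw [cosh_sideLength_hyperbolic h₂ h₃ hφ₁]
    have h4 : Real.sinh r₂ * Real.sinh r₃ ≤ Real.cosh r₂ * Real.cosh r₃ :=
      mul_le_mul (Real.sinh_lt_cosh r₂).le (Real.sinh_lt_cosh r₃).le s3.le c2.le
    nlinarith [mul_le_of_le_one_left (mul_pos s2 s3).le (Real.cos_le_one φ₁)]
  have hD := Real.cosh_pos (sideLength .hyperbolic φ₃ r₁ r₂ - sideLength .hyperbolic φ₂ r₃ r₁)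
  rw [Real.cosh_sub] at hD
  have hAB := mul_le_mul hA hB (by positivity) ((by positivity : (0 : ℝ) ≤ _).trans hA)
  have hP : 0 < Real.sinh r₁ * Real.cosh r₂ * (Real.sinh r₁ * Real.cosh r₃) := by positivity
  have hS := hP.trans_le hAB
  have hE : 2 * (Real.cosh r₂ * Real.cosh r₃) ≤ 2 / Real.sinh r₁ ^ 2 *
      (Real.sinh (sideLength .hyperbolic φ₃ r₁ r₂) *
        Real.sinh (sideLength .hyperbolic φ₂ r₃ r₁)) := by
    refine le_trans (le_of_eq ?_) (mul_le_mul_of_nonneg_left hAB (by positivity))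
    field_simp
  rw [lawCos, le_div_iff₀ hS]
  linarith

theorem innerAngle_mem (G : Geometry) {r₁ r₂ r₃ φ₁ φ₂ φ₃ : ℝ} (h₁ : 0 < r₁) (h₂ : 0 < r₂)
    (h₃ : 0 < r₃) (hφ₁ : φ₁ ∈ Set.Icc 0 (Real.pi / 2)) (hφ₂ : φ₂ ∈ Set.Icc 0 (Real.pi / 2))
    (hφ₃ : φ₃ ∈ Set.Icc 0 (Real.pi / 2)) :
    innerAngle G r₁ r₂ r₃ φ₁ φ₂ φ₃ ∈ Set.Icc 0 Real.pi := by
  rw [innerAngle_eq G h₁ h₂ h₃ hφ₁ hφ₂ hφ₃]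
  exact ⟨Real.arccos_nonneg _, Real.arccos_le_pi _⟩

theorem exists_innerAngle_hyperbolic_le {ε : ℝ} (hε : 0 < ε) (hπ : ε ≤ Real.pi) :
    ∃ M : ℝ, ∀ r₁ r₂ r₃ φ₁ φ₂ φ₃ : ℝ, 0 < r₁ → 0 < r₂ → 0 < r₃ → M ≤ r₁ →
      φ₁ ∈ Set.Icc 0 (Real.pi / 2) → φ₂ ∈ Set.Icc 0 (Real.pi / 2) →
      φ₃ ∈ Set.Icc 0 (Real.pi / 2) → innerAngle .hyperbolic r₁ r₂ r₃ φ₁ φ₂ φ₃ ≤ ε := by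
  have hcos : 0 < 1 - Real.cos ε := by
    have := Real.cos_lt_cos_of_nonneg_of_le_pi le_rfl hπ hε
    rw [Real.cos_zero] at this
    linarith
  refine ⟨Real.arsinh (2 / (1 - Real.cos ε) + 1), fun r₁ r₂ r₃ φ₁ φ₂ φ₃ h₁ h₂ h₃ hM i₁ i₂ i₃ => ?_⟩
  have h := one_sub_le_lawCos_sideLength h₁ h₂ h₃ i₁ i₂ i₃
  have hs : 2 / (1 - Real.cos ε) + 1 ≤ Real.sinh r₁ := by
    rw [← Real.sinh_arsinh (2 / (1 - Real.cos ε) + 1)]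
    exact Real.sinh_le_sinh.2 hM
  have hd : 0 < 2 / (1 - Real.cos ε) := by positivity
  have hs2 : 2 / (1 - Real.cos ε) ≤ Real.sinh r₁ ^ 2 := by nlinarith
  have h5 : 2 / Real.sinh r₁ ^ 2 ≤ 1 - Real.cos ε := by
    rw [div_le_iff₀ hcos] at hs2
    rw [div_le_iff₀ (by nlinarith)]
    linarith
  rw [innerAngle_eq _ h₁ h₂ h₃ i₁ i₂ i₃, ← Real.arccos_cos hε.le hπ]
  exact Real.arccos_le_arccos (by linarith)

theorem sinh_le_self_mul_cosh {x : ℝ} (hx : 0 ≤ x) : Real.sinh x ≤ x * Real.cosh x := by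
  have h := Convex.image_sub_le_mul_sub_of_deriv_le (convex_Icc 0 x)
    Real.continuous_sinh.continuousOn Real.differentiable_sinh.differentiableOn
    (C := Real.cosh x) (fun y hy => by
      rw [interior_Icc] at hy
      rw [Real.deriv_sinh, Real.cosh_le_cosh, abs_of_pos hy.1, abs_of_nonneg hx]
      exact hy.2.le) 0 ⟨le_rfl, hx⟩ x ⟨hx, le_rfl⟩ hx
  simpa [mul_comm] using h

/-! ### The cone angle and the curvature -/

section Curvature

variable {X V E F : Type*} [TopologicalSpace X] [Fintype F] {T : TriangularCellDivision X V E F}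
  {Φ : E → ℝ} {r : V → ℝ}

theorem coneAngle_nonneg (G : Geometry) (hΦ : ∀ e, Φ e ∈ Set.Icc 0 (Real.pi / 2))
    (hr : ∀ v, 0 < r v) (v : V) : 0 ≤ coneAngle G T Φ r v := by
  refine Finset.sum_nonneg fun f _ => Finset.sum_nonneg fun i _ => ?_
  split_ifs
  · exact (innerAngle_mem G (hr _) (hr _) (hr _) (hΦ _) (hΦ _) (hΦ _)).1
  · exact le_rfl

theorem coneAngle_le {G : Geometry} {ε : ℝ} (hε : 0 ≤ ε) {v : V}
    (h : ∀ f i, T.corner f i = v → cornerAngle G T Φ r f i ≤ ε) :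
    coneAngle G T Φ r v ≤ Fintype.card F * (3 * ε) := by
  refine (Finset.sum_le_card_nsmul _ _ (3 * ε) fun f _ => ?_).trans_eq (by simp)
  refine (Finset.sum_le_card_nsmul _ _ ε fun i _ => ?_).trans_eq (by simp)
  split_ifs with hi
  · exact h f i hi
  · exact hε

theorem exists_coneAngle_hyperbolic_lt_pi (T : TriangularCellDivision X V E F)
    (hΦ : ∀ e, Φ e ∈ Set.Icc 0 (Real.pi / 2)) :
    ∃ M : ℝ, ∀ r : V → ℝ, (∀ v, 0 < r v) → ∀ v, M ≤ r v →
      coneAngle .hyperbolic T Φ r v < Real.pi := by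
  have hπ := Real.pi_pos
  have hn : (0 : ℝ) ≤ Fintype.card F := Nat.cast_nonneg _
  -- At most `3 * card F` corners meet at a vertex.
  obtain ⟨M, hM⟩ := exists_innerAngle_hyperbolic_le (ε := Real.pi / (Fintype.card F * 3 + 1))
    (by positivity) (div_le_self hπ.le (by linarith))
  refine ⟨M, fun r hr v hv => (coneAngle_le (ε := Real.pi / (Fintype.card F * 3 + 1))
    (by positivity) fun f i hi => hM _ _ _ _ _ _ (hr _) (hr _) (hr _) (by rwa [hi]) (hΦ _) (hΦ _)
      (hΦ _)).trans_lt ?_⟩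
  rw [← mul_assoc, mul_div_assoc', div_lt_iff₀ (by positivity)]
  linarith

variable [ChartedSpace (EuclideanHalfSpace 2) X]

theorem exists_abs_curvature_le (G : Geometry) (T : TriangularCellDivision X V E F)
    (hΦ : ∀ e, Φ e ∈ Set.Icc 0 (Real.pi / 2)) :
    ∃ c : ℝ, ∀ r : V → ℝ, (∀ v, 0 < r v) → ∀ v, |curvature G T Φ r v| ≤ c := by
  refine ⟨2 * Real.pi + Fintype.card F * (3 * Real.pi), fun r hr v => ?_⟩
  have h1 := coneAngle_nonneg (T := T) G hΦ hr v
  have h2 := coneAngle_le (T := T) (G := G) Real.pi_pos.le fun f i (_ : T.corner f i = v) =>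
    (innerAngle_mem G (hr _) (hr _) (hr _) (hΦ _) (hΦ _) (hΦ _)).2
  have hπ := Real.pi_pos
  have hn : 0 ≤ Fintype.card F * (3 * Real.pi) := by positivity
  rw [curvature, abs_le]
  split_ifs <;> constructor <;> linarith

theorem exists_curvature_hyperbolic_pos (T : TriangularCellDivision X V E F)
    (hΦ : ∀ e, Φ e ∈ Set.Icc 0 (Real.pi / 2)) :
    ∃ M : ℝ, ∀ r : V → ℝ, (∀ v, 0 < r v) → ∀ v, M ≤ r v →
      0 < curvature .hyperbolic T Φ r v := by
  obtain ⟨M, hM⟩ := exists_coneAngle_hyperbolic_lt_pi T hΦ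
  refine ⟨M, fun r hr v hv => ?_⟩
  have h := hM r hr v hv
  rw [curvature]
  split_ifs <;> linarith [Real.pi_pos]

/-! ### The flow in logarithmic coordinates -/

/-- The vector field of the flow in the coordinates `u = log r`, which range over the whole
vector space `V → ℝ`. -/
noncomputable def logField (G : Geometry) (T : TriangularCellDivision X V E F) (Φ : E → ℝ)
    (u : V → ℝ) (v : V) : ℝ :=
  -curvature G T Φ (fun w => Real.exp (u w)) v * (sFun G (Real.exp (u v)) / Real.exp (u v))

theorem IsRicciFlowOn.hasDerivWithinAt_log {G : Geometry} {J : Set ℝ} {r : ℝ → V → ℝ}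
    (h : IsRicciFlowOn G T Φ J r) {t : ℝ} (ht : t ∈ J) :
    HasDerivWithinAt (fun τ v => Real.log (r τ v))
      (logField G T Φ fun v => Real.log (r t v)) J t := by
  rw [hasDerivWithinAt_pi]
  intro v
  have h1 := ((h t ht v).2).log (h t ht v).1.ne'
  simp only [logField, Real.exp_log (h t ht _).1]
  rwa [← mul_div_assoc]

theorem isRicciFlowOn_exp {G : Geometry} {J : Set ℝ} {u : ℝ → V → ℝ}
    (h : ∀ t ∈ J, HasDerivWithinAt u (logField G T Φ (u t)) J t) :
    IsRicciFlowOn G T Φ J fun t v => Real.exp (u t v) := by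
  refine fun t ht v => ⟨Real.exp_pos _, ?_⟩
  have h1 := (hasDerivWithinAt_pi.1 (h t ht) v).exp
  convert h1 using 1
  have := (Real.exp_pos (u t v)).ne'
  simp only [logField]
  field_simp

theorem IsRicciFlowOn.mono {G : Geometry} {J J' : Set ℝ} {r : ℝ → V → ℝ}
    (h : IsRicciFlowOn G T Φ J r) (hJ : J' ⊆ J) : IsRicciFlowOn G T Φ J' r :=
  fun t ht v => ⟨(h t (hJ ht) v).1, (h t (hJ ht) v).2.mono hJ⟩

variable [Fintype V]

theorem contDiff_logField (G : Geometry) (T : TriangularCellDivision X V E F)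
    (hΦ : ∀ e, Φ e ∈ Set.Icc 0 (Real.pi / 2)) : ContDiff ℝ 1 (logField G T Φ) := by
  rw [contDiff_pi]
  intro v
  have hexp : ∀ w : V, ContDiff ℝ 1 fun u : V → ℝ => Real.exp (u w) := fun w => by fun_prop
  refine ContDiff.mul (ContDiff.neg (contDiff_const.sub ?_)) ?_
  · refine ContDiff.sum fun f _ => ContDiff.sum fun i _ => ?_
    split_ifs
    · exact contDiff_iff_contDiffAt.2 fun u => contDiffAt_innerAngle G (hΦ _) (hΦ _) (hΦ _)
        (hexp _).contDiffAt (hexp _).contDiffAt (hexp _).contDiffAt (fun _ => Real.exp_pos _)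
        (fun _ => Real.exp_pos _) (fun _ => Real.exp_pos _)
    · exact contDiff_const
  · refine ContDiff.div ?_ (hexp v) fun u => (Real.exp_pos _).ne'
    cases G
    · exact hexp v
    · exact (hexp v).sinh

theorem exists_lipschitzOnWith_logField (G : Geometry) (T : TriangularCellDivision X V E F)
    (hΦ : ∀ e, Φ e ∈ Set.Icc 0 (Real.pi / 2)) (R : ℝ) :
    ∃ K, LipschitzOnWith K (logField G T Φ) (Metric.closedBall 0 R) :=
  (contDiff_logField G T hΦ).contDiffOn.exists_lipschitzOnWith one_ne_zero
    (convex_closedBall _ _) (isCompact_closedBall _ _)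

theorem IsRicciFlowOn.eqOn_Ico {G : Geometry} (hΦ : ∀ e, Φ e ∈ Set.Icc 0 (Real.pi / 2)) {a : ℝ}
    {r ρ : ℝ → V → ℝ} (hr : IsRicciFlowOn G T Φ (Set.Ico 0 a) r)
    (hρ : IsRicciFlowOn G T Φ (Set.Ico 0 a) ρ) (h0 : r 0 = ρ 0) : Set.EqOn r ρ (Set.Ico 0 a) := by
  intro t ht
  have hsub : Set.Icc 0 t ⊆ Set.Ico 0 a := fun s hs => ⟨hs.1, hs.2.trans_lt ht.2⟩
  have h := eqOn_Icc_of_hasDerivWithinAt (exists_lipschitzOnWith_logField G T hΦ)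
    (fun s hs => (hr.mono hsub).hasDerivWithinAt_log hs)
    (fun s hs => (hρ.mono hsub).hasDerivWithinAt_log hs) (by simp only [h0]) ⟨ht.1, le_rfl⟩
  exact funext fun v => Real.log_injOn_pos (hr t ht v).1 (hρ t ht v).1 (congrFun h v)

theorem norm_logField_le {G : Geometry} {c S : ℝ}
    (hc : ∀ r : V → ℝ, (∀ v, 0 < r v) → ∀ v, |curvature G T Φ r v| ≤ c) (hc0 : 0 ≤ c) (hS0 : 0 ≤ S)
    {u : V → ℝ} (hS : ∀ v, |sFun G (Real.exp (u v)) / Real.exp (u v)| ≤ S) :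
    ‖logField G T Φ u‖ ≤ c * S := by
  refine (pi_norm_le_iff_of_nonneg (by positivity)).2 fun v => ?_
  rw [logField, Real.norm_eq_abs, abs_mul, abs_neg]
  exact mul_le_mul (hc _ (fun _ => Real.exp_pos _) v) (hS v) (abs_nonneg _) hc0

theorem exists_logField_euclidean_solution (hΦ : ∀ e, Φ e ∈ Set.Icc 0 (Real.pi / 2)) (u₀ : V → ℝ) :
    ∃ u : ℝ → V → ℝ, u 0 = u₀ ∧ ∀ t ∈ Set.Ici 0,
      HasDerivWithinAt u (logField .euclidean T Φ (u t)) (Set.Ici 0) t := by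
  obtain ⟨c, hc⟩ := exists_abs_curvature_le .euclidean T hΦ
  refine exists_hasDerivWithinAt_Ici (exists_lipschitzOnWith_logField .euclidean T hΦ)
    (L := max c 0 * 1) (fun u => norm_logField_le (fun r hr v => (hc r hr v).trans (le_max_left c 0))
      (le_max_right _ _) zero_le_one fun v => ?_) u₀
  simp [sFun]

/-- The hyperbolic field is unbounded only because of the factor `sinh r / r`, so it is first
evaluated at `min u B`. The curvature is positive at a vertex with `u = B`, hence a solution of the
truncated equation starting below `B` stays below `B`, where the truncation changes nothing. -/
theorem exists_logField_hyperbolic_solution (hΦ : ∀ e, Φ e ∈ Set.Icc 0 (Real.pi / 2))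
    (u₀ : V → ℝ) :
    ∃ u : ℝ → V → ℝ, u 0 = u₀ ∧ ∀ t ∈ Set.Ici 0,
      HasDerivWithinAt u (logField .hyperbolic T Φ (u t)) (Set.Ici 0) t := by
  obtain ⟨c, hc⟩ := exists_abs_curvature_le .hyperbolic T hΦ
  obtain ⟨M, hM⟩ := exists_curvature_hyperbolic_pos T hΦ
  obtain ⟨A, hA⟩ := (Set.finite_range u₀).bddAbove
  -- `M ≤ B ≤ exp B`, so the curvature is positive at radii of at least `exp B`.
  obtain ⟨B, hBM, hBA⟩ : ∃ B, M ≤ B ∧ A ≤ B := ⟨max M A, le_max_left _ _, le_max_right _ _⟩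
  have hMexp : M ≤ Real.exp B := by linarith [Real.add_one_le_exp B]
  obtain ⟨trunc, htrunc⟩ : ∃ trunc : (V → ℝ) → V → ℝ, trunc = fun u v => min (u v) B := ⟨_, rfl⟩
  have htl : LipschitzWith 1 trunc := by
    refine LipschitzWith.of_dist_le_mul fun x y => ?_
    rw [NNReal.coe_one, one_mul, dist_pi_le_iff dist_nonneg, htrunc]
    intro v
    refine le_trans ?_ (dist_le_pi_dist x y v)
    simpa using (LipschitzWith.id.min_const B).dist_le_mul (x v) (y v)
  have hlip : ∀ R : ℝ, ∃ K, LipschitzOnWith K (logField .hyperbolic T Φ ∘ trunc)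
      (Metric.closedBall 0 R) := fun R => by
    obtain ⟨K, hK⟩ := exists_lipschitzOnWith_logField .hyperbolic T hΦ (R + dist (trunc 0) 0)
    refine ⟨K * 1, hK.comp htl.lipschitzOnWith fun u hu => ?_⟩
    have h1 := htl.dist_le_mul u 0
    rw [NNReal.coe_one, one_mul] at h1
    exact (dist_triangle _ _ _).trans (add_le_add_left (h1.trans hu) _)
  have hbd : ∀ u, ‖(logField .hyperbolic T Φ ∘ trunc) u‖ ≤ max c 0 * Real.cosh (Real.exp B) :=
    fun u => by
    refine norm_logField_le (fun r hr v => (hc r hr v).trans (le_max_left c 0)) (le_max_right _ _)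
      (Real.cosh_pos _).le fun v => ?_
    have he := Real.exp_pos (trunc u v)
    have hle : Real.exp (trunc u v) ≤ Real.exp B :=
      Real.exp_le_exp.2 (by rw [htrunc]; exact min_le_right _ _)
    have hs := Real.sinh_pos_iff.2 he
    rw [sFun, abs_of_pos (by positivity), div_le_iff₀ he, mul_comm]
    refine (sinh_le_self_mul_cosh he.le).trans (mul_le_mul_of_nonneg_left ?_ he.le)
    rwa [Real.cosh_le_cosh, abs_of_pos he, abs_of_pos (Real.exp_pos B)]
  obtain ⟨u, hu0, hu⟩ := exists_hasDerivWithinAt_Ici hlip hbd u₀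
  refine ⟨u, hu0, fun t ht => ?_⟩
  have hle : ∀ v, u t v ≤ B := fun v => by
    refine le_of_hasDerivWithinAt_neg (fun s hs => hasDerivWithinAt_pi.1 (hu s hs) v)
      (by rw [hu0]; exact (hA (Set.mem_range_self v)).trans hBA) (fun s _ hsB => ?_) ht
    have htv : trunc (u s) v = B := by simp [htrunc, hsB]
    have hK := hM (fun w => Real.exp (trunc (u s) w)) (fun _ => Real.exp_pos _) v
      (by rwa [htv])
    have hs := Real.sinh_pos_iff.2 (Real.exp_pos (trunc (u s) v))
    have he := Real.exp_pos (trunc (u s) v)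
    simp only [Function.comp_apply, logField, sFun]
    exact mul_neg_of_neg_of_pos (neg_neg_of_pos hK) (by positivity)
  have h := hu t ht
  have htu : trunc (u t) = u t := by
    rw [htrunc]
    exact funext fun v => min_eq_left (hle v)
  rwa [Function.comp_apply, htu] at h

/-- A radius can never cross a level beyond which the curvature is positive, since it is decreasing
there. -/
theorem IsRicciFlowOn.exists_le_hyperbolic (hΦ : ∀ e, Φ e ∈ Set.Icc 0 (Real.pi / 2))
    {r : ℝ → V → ℝ} (hr : IsRicciFlowOn .hyperbolic T Φ (Set.Ici 0) r) :
    ∃ C : ℝ, ∀ t : ℝ, 0 ≤ t → ∀ v, r t v ≤ C := by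
  obtain ⟨M, hM⟩ := exists_curvature_hyperbolic_pos T hΦ
  obtain ⟨A, hA⟩ := (Set.finite_range (r 0)).bddAbove
  refine ⟨max M A, fun t ht v => le_of_hasDerivWithinAt_neg (fun s hs => (hr s hs v).2)
    ((hA (Set.mem_range_self v)).trans (le_max_right _ _)) (fun s hs hsC => ?_) ht⟩
  have hK := hM (r s) (fun w => (hr s hs w).1) v (hsC ▸ le_max_left _ _)
  exact mul_neg_of_neg_of_pos (neg_neg_of_pos hK) (Real.sinh_pos_iff.2 (hr s hs v).1)

end Curvature

end CombinatorialRicciFlow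

theorem proposition3p4 {X V E F : Type*} [TopologicalSpace X] [T2Space X] [CompactSpace X]
    [ConnectedSpace X] [ChartedSpace (EuclideanHalfSpace 2) X] [Finite V] [Finite E] [Fintype F]
    (T : CombinatorialRicciFlow.TriangularCellDivision X V E F)
    (Φ : E → ℝ) (hΦ : ∀ e, Φ e ∈ Set.Icc 0 (Real.pi / 2)) :
    (∀ (G : CombinatorialRicciFlow.Geometry) (r₀ : V → ℝ), (∀ v, 0 < r₀ v) →
      ∃ r : ℝ → V → ℝ, r 0 = r₀ ∧
        CombinatorialRicciFlow.IsRicciFlowOn G T Φ (Set.Ici 0) r ∧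
        ∀ (a : ℝ) (ρ : ℝ → V → ℝ), ρ 0 = r₀ →
          CombinatorialRicciFlow.IsRicciFlowOn G T Φ (Set.Ico 0 a) ρ →
          Set.EqOn ρ r (Set.Ico 0 a)) ∧
    (∀ r : ℝ → V → ℝ,
      CombinatorialRicciFlow.IsRicciFlowOn .hyperbolic T Φ (Set.Ici 0) r →
      ∃ C : ℝ, ∀ t : ℝ, 0 ≤ t → ∀ v, r t v ≤ C) := by
  obtain ⟨_⟩ := nonempty_fintype V
  refine ⟨fun G r₀ hr₀ => ?_, fun r hr => hr.exists_le_hyperbolic hΦ⟩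
  obtain ⟨u, hu0, hu⟩ : ∃ u : ℝ → V → ℝ, u 0 = (fun v => Real.log (r₀ v)) ∧ ∀ t ∈ Set.Ici 0,
      HasDerivWithinAt u (CombinatorialRicciFlow.logField G T Φ (u t)) (Set.Ici 0) t := by
    cases G
    · exact CombinatorialRicciFlow.exists_logField_euclidean_solution hΦ _
    · exact CombinatorialRicciFlow.exists_logField_hyperbolic_solution hΦ _
  have hflow := CombinatorialRicciFlow.isRicciFlowOn_exp hu
  have h0 : (fun v => Real.exp (u 0 v)) = r₀ := by
    simp only [hu0, Real.exp_log (hr₀ _)]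
  exact ⟨_, h0, hflow, fun a ρ hρ0 hρ =>
    hρ.eqOn_Ico hΦ (hflow.mono Set.Ico_subset_Ici_self) (hρ0.trans h0.symm)⟩
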